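/- Let $H$ be a complex Hilbert space and $P(H)$ the complete orthomodular lattice of its orthogonal projections (closed subspaces), with orthocomplement $a\mapsto a^{\perp}$. Let $\mathcal B$ be the set of complete Boolean subalgebras $B$ of $P(H)$, ordered by inclusion; for $B\in\mathcal B$ let $\Omega_B$ be its Stone space (the Boolean homomorphisms $B\to\{0,1\}$, with basic open sets $\{x : x(b)=1\}$, $b\in B$). The spectral presheaf $\underline\Omega$ is $B\mapsto\Omega_B$ with the restriction maps. A clopen subobject $S$ is a family of clopen sets $S_B\subseteq\Omega_B$ such that $x\in S_B$ and $B'\subseteq B$ imply $x|_{B'}\in S_{B'}$. Ordered by componentwise inclusion, the clopen subobjects form a complete Heyting algebra $A=\mathrm{Sub}_{cl}(\underline\Omega)$. For $a\in P(H)$ let $\delta(a)\in A$ be given by $\delta(a)_B=\{x\in\Omega_B : x(\bigwedge\{b\in B: b\ge a\})=1\}$, and for $S\in A$ put $$\varepsilon(S)=\bigvee\{a\in P(H):\delta(a)\le S\},\qquad S^{*}=\delta(\varepsilon(S)^{\perp}),\qquad S\Rightarrow_{*}T\;=\;S^{*}\vee T .$$ Let $E$ be the set of classes $[S]$ for the relation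 $S\sim T\iff\varepsilon(S)=\varepsilon(T)$, and let $g:E\to P(H)$, $g([S])=\varepsilon(S)$ (the Döring–Cannon isomorphism). Let $V^{(A)}$ be the Heyting valued universe over $A$, with $$\|x\in v\|=\bigvee_{y\in \mathrm{dom}(v)}v(y)\wedge\|x=y\|,\qquad \|u=v\|=\bigwedge_{x\in \mathrm{dom}(u)}(u(x)\Rightarrow\|x\in v\|)\wedge\bigwedge_{y\in \mathrm{dom}(v)}(v(y)\Rightarrow\|y\in u\|),$$ where $\Rightarrow$ is the Heyting implication, and let $\hat q$ be the standard name of $q\in\mathbb Q$. Let $\mathbb R^{(A)}$ be the set of all $u\in V^{(A)}$ such that the statement "$u$ is a Dedekind real" has truth value $\top$, that is, the statement "$u\subseteq\hat{\mathbb Q}$, some rational is in $u$, some rational is not in $u$, and for every rational $q$: $q\in u$ if and only if $r\in u$ for all rationals $r>q$". For $u\in\mathbb R^{(A)}$ and $\lambda\in\mathbb R$ put $$E^{u}_{\lambda}=\bigwedge_{q\in\mathbb Q,\ q>\lambda}\|\hat q\in u\|,\qquad G^{u}_{\lambda}=g([E^{u}_{\lambda}])\in P(H).$$ Let $WSA(H)$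 be the set of weakly self-adjoint operators on $H$, i.e. of weakly right-continuous spectral families: families $(F_\lambda)_{\lambda\in\mathbb R}$ in $P(H)$ with $\bigwedge_\lambda F_\lambda=0$ and $\bigwedge_{\mu>\lambda}F_\mu=F_\lambda$ for all $\lambda$ (it is not required that $\bigvee_\lambda F_\lambda=1$). Then $G(u)=(G^{u}_{\lambda})_{\lambda\in\mathbb R}$ defines a map $G:\mathbb R^{(A)}\to WSA(H)$, and $G$ is injective with respect to the equality of $V^{(A)}$ computed with $*$ in place of the Heyting negation. Precisely: let $\|u=v\|_{*}$ be defined by the same recursion as above with $\Rightarrow_{*}$ in place of $\Rightarrow$ throughout. Then for all $u,v\in\mathbb R^{(A)}$: 1. if $\|u=v\|_{*}\neq\top$, then $G(u)\neq G(v)$; 2. if $\bigwedge_{q\in\mathbb Q}\big((\|\hat q\in u\|\Rightarrow_{*}\|\hat q\in v\|)\wedge(\|\hat q\in v\|\Rightarrow_{*}\|\hat q\in u\|)\big)\neq\top$, the truth value under $\Rightarrow_{*}$ of "$u$ and $v$ contain the same rationals", then $G(u)\neq G(v)$. -/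

import Mathlib

universe u

/-! ## Complete orthomodular lattices and the projection lattice of a Hilbert space -/

/-- Complete orthomodular lattices; `aᶜ` is the orthocomplement of `a`. -/
class CompleteOrthomodularLattice (L : Type u) extends CompleteLattice L, Compl L where
  inf_ocompl_self : ∀ a : L, a ⊓ aᶜ = ⊥
  sup_ocompl_self : ∀ a : L, a ⊔ aᶜ = ⊤
  ocompl_ocompl : ∀ a : L, aᶜᶜ = a
  ocompl_le_ocompl : ∀ a b : L, a ≤ b → bᶜ ≤ aᶜ
  orthomodular : ∀ a b : L, a ≤ b → a ⊔ (aᶜ ⊓ b) = b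

/-- The projection lattice `P(H)` of a complex Hilbert space `H`, every orthogonal projection being
identified with its range, a closed linear subspace. Infima are intersections, suprema are closed
linear spans. -/
abbrev ProjLattice (H : Type u) [NormedAddCommGroup H] [InnerProductSpace ℂ H] : Type u :=
  ClosedSubmodule ℂ H

theorem ProjLattice.orthomodular_aux {H : Type u} [NormedAddCommGroup H] [InnerProductSpace ℂ H]
    [CompleteSpace H] (a b : ProjLattice H) (h : a ≤ b) : a ⊔ (aᗮ ⊓ b) = b := by
  apply le_antisymm (sup_le h inf_le_right)
  intro x hx
  have hc : CompleteSpace a.toSubmodule := a.isClosed.completeSpace_coe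
  have h1 : a.toSubmodule ⊔ (a.toSubmoduleᗮ ⊓ b.toSubmodule) = b.toSubmodule :=
    Submodule.sup_orthogonal_inf_of_hasOrthogonalProjection h
  have hx' : x ∈ a.toSubmodule ⊔ (a.toSubmoduleᗮ ⊓ b.toSubmodule) := by rw [h1]; exact hx
  obtain ⟨y, hy, z, hz, rfl⟩ := Submodule.mem_sup.1 hx'
  have hy' : y ∈ a ⊔ (aᗮ ⊓ b) := (le_sup_left : a ≤ a ⊔ (aᗮ ⊓ b)) hy
  have hz' : z ∈ a ⊔ (aᗮ ⊓ b) := (le_sup_right : aᗮ ⊓ b ≤ a ⊔ (aᗮ ⊓ b)) hz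
  exact add_mem hy' hz'

/-- The orthocomplement on `P(H)` is the orthogonal complement of closed subspaces. -/
noncomputable instance ProjLattice.instCompleteOrthomodularLattice (H : Type u)
    [NormedAddCommGroup H] [InnerProductSpace ℂ H] [CompleteSpace H] :
    CompleteOrthomodularLattice (ProjLattice H) where
  __ := (inferInstance : CompleteLattice (ClosedSubmodule ℂ H))
  compl a := aᗮ
  inf_ocompl_self a := by
    refine le_antisymm (fun x hx => ?_) bot_le
    obtain ⟨h1, h2⟩ : x ∈ a ∧ x ∈ a.toSubmoduleᗮ := hx
    have h0 : inner ℂ x x = 0 := h2 x h1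
    rw [inner_self_eq_zero] at h0
    rw [h0]
    exact zero_mem (⊥ : ClosedSubmodule ℂ H)
  sup_ocompl_self a := by
    have := ProjLattice.orthomodular_aux a ⊤ le_top
    rwa [inf_top_eq] at this
  ocompl_ocompl a := by
    ext x
    have hc : CompleteSpace a.toSubmodule := a.isClosed.completeSpace_coe
    have : a.toSubmoduleᗮᗮ = a.toSubmodule := Submodule.orthogonal_orthogonal _
    change x ∈ a.toSubmoduleᗮᗮ ↔ x ∈ a.toSubmodule
    rw [this]
  ocompl_le_ocompl a b h := ClosedSubmodule.orthogonal_le h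
  orthomodular a b h := ProjLattice.orthomodular_aux a b h

/-! ## The spectral presheaf -/

/-- A complete Boolean subalgebra `B` of `L`: it contains all suprema and infima (taken in `L`) of
its subsets and the orthocomplements of its elements, and it is distributive. These are the
contexts over which the spectral presheaf lives; completeness makes
`⋀ {b ∈ B | a ≤ b}` an element of `B`. -/
structure BoolContext (L : Type u) [CompleteOrthomodularLattice L] where
  alg : CompleteSublattice L
  compl_mem : ∀ a ∈ alg, aᶜ ∈ alg
  distrib : ∀ a ∈ alg, ∀ b ∈ alg, ∀ c ∈ alg, a ⊓ (b ⊔ c) = (a ⊓ b) ⊔ (a ⊓ c)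

/-- The Stone space `Ω_B`: homomorphisms of bounded lattices from `B` to `{0, 1}`, that is, Boolean
homomorphisms (preservation of complements is automatic). -/
def StoneSpace {L : Type u} [CompleteOrthomodularLattice L] (B : BoolContext L) : Type u :=
  BoundedLatticeHom B.alg Bool

namespace StoneSpace

variable {L : Type u} [CompleteOrthomodularLattice L] {B : BoolContext L}

/-- The value `x(b) ∈ {0, 1}`. -/
noncomputable def eval (x : StoneSpace B) (b : B.alg) : Bool := BoundedLatticeHom.toLatticeHom x b

/-- The basic set `U_b = {x | x(b) = 1}`. -/
def basic (b : B.alg) : Set (StoneSpace B) := {x | x.eval b = true}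

/-- The Stone topology, generated by the sets `U_b`. -/
instance : TopologicalSpace (StoneSpace B) :=
  TopologicalSpace.generateFrom (Set.range (basic (B := B)))

/-- Restriction of homomorphisms along an inclusion `B' ⊆ B`. -/
noncomputable def restrict {B' : BoolContext L} (h : B'.alg ≤ B.alg) (x : StoneSpace B) : StoneSpace B' where
  toFun b := x.eval ⟨b.1, h b.2⟩
  map_sup' a b := map_sup (BoundedLatticeHom.toLatticeHom x) (⟨a.1, h a.2⟩ : B.alg) (⟨b.1, h b.2⟩ : B.alg)
  map_inf' a b := map_inf (BoundedLatticeHom.toLatticeHom x) (⟨a.1, h a.2⟩ : B.alg) (⟨b.1, h b.2⟩ : B.alg)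
  map_top' := BoundedLatticeHom.map_top' x
  map_bot' := BoundedLatticeHom.map_bot' x

theorem eval_restrict {B' : BoolContext L} (h : B'.alg ≤ B.alg) (x : StoneSpace B) (b : B'.alg) :
    (restrict h x).eval b = x.eval ⟨b.1, h b.2⟩ := rfl

theorem eval_mono (x : StoneSpace B) {a b : B.alg} (h : a ≤ b) (ha : x.eval a = true) :
    x.eval b = true := by
  have h2 : x.eval a ≤ x.eval b := OrderHomClass.mono (BoundedLatticeHom.toLatticeHom x) h
  rw [ha] at h2
  exact top_le_iff.1 h2

theorem eval_inf (x : StoneSpace B) (a b : B.alg) : x.eval (a ⊓ b) = (x.eval a && x.eval b) :=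
  map_inf (BoundedLatticeHom.toLatticeHom x) a b

theorem eval_sup (x : StoneSpace B) (a b : B.alg) : x.eval (a ⊔ b) = (x.eval a || x.eval b) :=
  map_sup (BoundedLatticeHom.toLatticeHom x) a b

theorem eval_top (x : StoneSpace B) : x.eval ⊤ = true := BoundedLatticeHom.map_top' x

theorem eval_bot (x : StoneSpace B) : x.eval ⊥ = false := BoundedLatticeHom.map_bot' x

/-- The orthocomplement inside a context. -/
def ctxCompl (a : B.alg) : B.alg := ⟨a.1ᶜ, B.compl_mem _ a.2⟩

theorem inf_ctxCompl (a : B.alg) : a ⊓ ctxCompl a = ⊥ :=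
  Subtype.ext (CompleteOrthomodularLattice.inf_ocompl_self a.1)

theorem sup_ctxCompl (a : B.alg) : a ⊔ ctxCompl a = ⊤ :=
  Subtype.ext (CompleteOrthomodularLattice.sup_ocompl_self a.1)

theorem eval_ctxCompl (x : StoneSpace B) (a : B.alg) : x.eval (ctxCompl a) = !x.eval a := by
  have h1 := eval_inf x a (ctxCompl a)
  have h2 := eval_sup x a (ctxCompl a)
  rw [inf_ctxCompl, eval_bot] at h1
  rw [sup_ctxCompl, eval_top] at h2
  revert h1 h2
  cases x.eval a <;> cases x.eval (ctxCompl a) <;> simp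

theorem isOpen_basic (b : B.alg) : IsOpen (basic b) :=
  TopologicalSpace.isOpen_generateFrom_of_mem ⟨b, rfl⟩

theorem isClopen_basic (b : B.alg) : IsClopen (basic b) := by
  refine ⟨⟨?_⟩, isOpen_basic b⟩
  have : (basic b)ᶜ = basic (ctxCompl b) := by
    ext x; simp [basic, eval_ctxCompl]
  rw [this]
  exact isOpen_basic _

theorem exists_basic {U : Set (StoneSpace B)} (hU : IsOpen U) {x : StoneSpace B} (hx : x ∈ U) :
    ∃ b : B.alg, x ∈ basic b ∧ basic b ⊆ U := by
  induction hU with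
  | basic s hs => obtain ⟨b, rfl⟩ := hs; exact ⟨b, hx, subset_rfl⟩
  | univ => exact ⟨⊤, eval_top x, Set.subset_univ _⟩
  | inter s t _ _ ihs iht =>
    obtain ⟨b, hb, hbs⟩ := ihs hx.1
    obtain ⟨c, hc, hct⟩ := iht hx.2
    refine ⟨b ⊓ c, ?_, fun y hy => ⟨hbs ?_, hct ?_⟩⟩
    · change x.eval (b ⊓ c) = true
      have hb' : x.eval b = true := hb
      have hc' : x.eval c = true := hc
      simp [eval_inf, hb', hc']
    · exact eval_mono y inf_le_left hy
    · exact eval_mono y inf_le_right hy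
  | sUnion S _ ih =>
    obtain ⟨s, hs, hxs⟩ := hx
    obtain ⟨b, hb, hbs⟩ := ih s hs hxs
    exact ⟨b, hb, hbs.trans (Set.subset_sUnion_of_mem hs)⟩

theorem continuous_restrict {B' : BoolContext L} (h : B'.alg ≤ B.alg) :
    Continuous (restrict (B := B) (B' := B') h) := by
  refine continuous_generateFrom_iff.2 ?_
  rintro _ ⟨b, rfl⟩
  exact isOpen_basic (B := B) ⟨b.1, h b.2⟩

/-- The distributive lattice structure of a context. -/
@[reducible] def distribLattice (B : BoolContext L) : DistribLattice B.alg :=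
  DistribLattice.ofInfSupLe fun a b c =>
    le_of_eq (Subtype.ext (B.distrib a.1 a.2 b.1 b.2 c.1 c.2))

/-- Stone separation: every nonzero element of a context takes the value `1` somewhere. -/
theorem basic_nonempty {b : B.alg} (hb : b ≠ ⊥) : (basic b).Nonempty := by
  classical
  let _ : DistribLattice B.alg := distribLattice B
  have hd : Disjoint ((Order.PFilter.principal b : Order.PFilter B.alg) : Set B.alg)
      ((Order.Ideal.principal (⊥ : B.alg) : Order.Ideal B.alg) : Set B.alg) := by
    rw [Set.disjoint_left]
    intro x hx hx'
    have h1 : b ≤ x := hx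
    have h2 : x ≤ ⊥ := hx'
    exact hb (le_bot_iff.1 (h1.trans h2))
  obtain ⟨J, hJ, -, hJd⟩ := DistribLattice.prime_ideal_of_disjoint_filter_ideal hd
  have hbot : (⊥ : B.alg) ∈ J := J.bot_mem
  have htop : (⊤ : B.alg) ∉ J := fun h =>
    Set.disjoint_left.1 hJd (show (⊤ : B.alg) ∈ (Order.PFilter.principal b : Set B.alg) from
      (le_top : b ≤ ⊤)) h
  have hbJ : b ∉ J := fun h =>
    Set.disjoint_left.1 hJd (show b ∈ (Order.PFilter.principal b : Set B.alg) from le_refl b) h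
  let x : BoundedLatticeHom B.alg Bool :=
    { toFun := fun a => decide (a ∉ J)
      map_sup' := by
        intro a c
        have : a ⊔ c ∈ J ↔ a ∈ J ∧ c ∈ J := Order.Ideal.sup_mem_iff
        by_cases h1 : a ∈ J <;> by_cases h2 : c ∈ J <;> simp [this, h1, h2]
      map_inf' := by
        intro a c
        have : a ⊓ c ∈ J ↔ a ∈ J ∨ c ∈ J :=
          ⟨fun h => hJ.mem_or_mem h, fun h => h.elim (fun h => J.lower inf_le_left h)
            (fun h => J.lower inf_le_right h)⟩
        by_cases h1 : a ∈ J <;> by_cases h2 : c ∈ J <;> simp [this, h1, h2]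
      map_top' := by simp [htop]
      map_bot' := by simp [hbot] }
  exact ⟨x, show decide (b ∉ J) = true by simp [hbJ]⟩

/-- The Stone space of a complete Boolean algebra is extremally disconnected. -/
theorem isClopen_closure {U : Set (StoneSpace B)} (hU : IsOpen U) : IsClopen (closure U) := by
  suffices h : closure U = basic (sSup {c : B.alg | basic c ⊆ U}) by
    rw [h]; exact isClopen_basic _
  apply subset_antisymm
  · refine closure_minimal (fun x hx => ?_) (isClopen_basic _).1
    obtain ⟨c, hxc, hc⟩ := exists_basic hU hx
    exact eval_mono x (le_sSup hc) hxc
  · intro x hx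
    rw [mem_closure_iff]
    intro V hV hxV
    obtain ⟨d, hxd, hd⟩ := exists_basic hV hxV
    by_contra hne
    have hle : sSup {c : B.alg | basic c ⊆ U} ≤ ctxCompl d := by
      refine sSup_le fun c hc => ?_
      have hcd : c ⊓ d = ⊥ := by
        by_contra h0
        obtain ⟨y, hy⟩ := basic_nonempty h0
        exact hne ⟨y, hd (eval_mono y inf_le_right hy), hc (eval_mono y inf_le_left hy)⟩
      let _ : DistribLattice B.alg := distribLattice B
      calc c = c ⊓ (d ⊔ ctxCompl d) := by rw [sup_ctxCompl]; simp
        _ = (c ⊓ d) ⊔ (c ⊓ ctxCompl d) := inf_sup_left _ _ _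
        _ = c ⊓ ctxCompl d := by rw [hcd]; simp
        _ ≤ ctxCompl d := inf_le_right
    have h1 := eval_mono x hle hx
    rw [eval_ctxCompl] at h1
    have h2 : x.eval d = true := hxd
    simp [h2] at h1

end StoneSpace

/-- A clopen subobject of the spectral presheaf: a clopen subset of every `Ω_B`, compatible with
restriction. -/
@[ext] structure SubCl (L : Type u) [CompleteOrthomodularLattice L] where
  obj : ∀ B : BoolContext L, Set (StoneSpace B)
  isClopen : ∀ B, IsClopen (obj B)
  restrict_mem : ∀ (B B' : BoolContext L) (h : B'.alg ≤ B.alg) (x : StoneSpace B),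
    x ∈ obj B → StoneSpace.restrict h x ∈ obj B'

namespace SubCl

variable {L : Type u} [CompleteOrthomodularLattice L]

/-- Clopen subobjects are ordered by componentwise inclusion. -/
instance : PartialOrder (SubCl L) where
  le S T := ∀ B, S.obj B ⊆ T.obj B
  le_refl _ _ := subset_rfl
  le_trans _ _ _ h1 h2 B := (h1 B).trans (h2 B)
  le_antisymm S T h1 h2 := SubCl.ext (funext fun B => subset_antisymm (h1 B) (h2 B))

/-- The supremum is the componentwise closure of the union. -/
instance : SupSet (SubCl L) where
  sSup A :=
    { obj := fun B => closure (⋃ S ∈ A, S.obj B)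
      isClopen := fun B => StoneSpace.isClopen_closure
        (isOpen_biUnion fun S _ => (S.isClopen B).2)
      restrict_mem := fun B B' h x hx => by
        refine map_mem_closure (StoneSpace.continuous_restrict h) hx ?_
        intro y hy
        simp only [Set.mem_iUnion] at hy ⊢
        obtain ⟨S, hS, hy⟩ := hy
        exact ⟨S, hS, S.restrict_mem B B' h y hy⟩ }

/-- The binary infimum is the componentwise intersection. -/
instance : Min (SubCl L) where
  min S T :=
    { obj := fun B => S.obj B ∩ T.obj B
      isClopen := fun B => (S.isClopen B).inter (T.isClopen B)
      restrict_mem := fun B B' h x hx =>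
        ⟨S.restrict_mem B B' h x hx.1, T.restrict_mem B B' h x hx.2⟩ }

theorem isLUB_sSup' (A : Set (SubCl L)) : IsLUB A (sSup A) := by
  refine ⟨fun S hS B => ?_, fun T hT B => ?_⟩
  · exact (Set.subset_biUnion_of_mem (u := fun S : SubCl L => S.obj B) hS).trans subset_closure
  · exact closure_minimal (Set.iUnion₂_subset fun S hS => hT hS B) (T.isClopen B).1

/-- `Sub_cl(Ω)` is a complete lattice. -/
instance : CompleteLattice (SubCl L) where
  __ := completeLatticeOfSup (SubCl L) isLUB_sSup'
  inf := (· ⊓ ·)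
  inf_le_left _ _ _ := Set.inter_subset_left
  inf_le_right _ _ _ := Set.inter_subset_right
  le_inf _ _ _ h1 h2 B := Set.subset_inter (h1 B) (h2 B)

/-- `Sub_cl(Ω)` is a complete Heyting algebra; `⇨` is its Heyting implication. -/
instance : Order.Frame (SubCl L) := Order.Frame.ofMinimalAxioms
  { inf_sSup_le_iSup_inf := by
      intro S A B x hx
      obtain ⟨h1, h2⟩ : x ∈ S.obj B ∧ x ∈ closure (⋃ T ∈ A, T.obj B) := hx
      have h3 := (S.isClopen B).2.inter_closure ⟨h1, h2⟩
      refine closure_minimal ?_ ((⨆ T ∈ A, S ⊓ T).isClopen B).1 h3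
      rintro y ⟨hy1, hy2⟩
      simp only [Set.mem_iUnion] at hy2
      obtain ⟨T, hT, hy2⟩ := hy2
      exact (le_iSup₂_of_le (f := fun T (_ : T ∈ A) => S ⊓ T) T hT le_rfl) B ⟨hy1, hy2⟩ }

/-- The outer daseinisation of `a`: at `B` it is the clopen set `{x | x(⋀ {b ∈ B | a ≤ b}) = 1}`. -/
def das (a : L) : SubCl L where
  obj B := StoneSpace.basic (sInf {b : B.alg | a ≤ b.1})
  isClopen B := StoneSpace.isClopen_basic _
  restrict_mem B B' h x hx := by
    change x.eval _ = true
    refine StoneSpace.eval_mono x ?_ hx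
    refine sInf_le ?_
    change a ≤ ((sInf {b : B'.alg | a ≤ b.1} : B'.alg) : L)
    rw [CompleteSublattice.coe_sInf']
    exact le_iInf₂ fun b hb => hb

/-- `ε(S) = ⋁ {a | δ(a) ≤ S}`, the upper adjoint of daseinisation. -/
def eps (S : SubCl L) : L := sSup {a : L | das a ≤ S}

/-- The negation `S* = δ(ε(S)ᶜ)`. -/
def star (S : SubCl L) : SubCl L := das (eps S)ᶜ

/-- The implication `S ⇒ T = S* ⊔ T` belonging to the negation `*`. -/
def starImp (S T : SubCl L) : SubCl L := star S ⊔ T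

/-- `S ∼ T` if and only if `ε(S) = ε(T)`. -/
def epsSetoid (L : Type u) [CompleteOrthomodularLattice L] : Setoid (SubCl L) where
  r S T := eps S = eps T
  iseqv := ⟨fun _ => rfl, fun h => h.symm, fun h1 h2 => h1.trans h2⟩

/-- The set `E` of `ε`-equivalence classes of clopen subobjects. -/
def EpsClass (L : Type u) [CompleteOrthomodularLattice L] : Type u := Quotient (epsSetoid L)

/-- The class `[S]`. -/
def toClass (S : SubCl L) : EpsClass L := Quotient.mk (epsSetoid L) S

/-- The map `g : E → L`, `g([S]) = ε(S)`. -/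
def EpsClass.g (c : EpsClass L) : L := Quotient.lift (s := epsSetoid L) eps (fun _ _ h => h) c

end SubCl

/-! ## Algebra valued sets -/

/-- The universe `V^(A)` of `A`-valued sets: such a set is a family of `A`-valued sets (its domain)
together with a truth value in `A` for every member of the family. -/
inductive AName (A : Type u) : Type (u + 1)
  | mk (ι : Type u) (dom : ι → AName A) (val : ι → A) : AName A

namespace AName

variable {A : Type u}

/-- The index type of the domain of `u`. -/
def Idx : AName A → Type u
  | mk ι _ _ => ι

/-- The members of the domain of `u`. -/
def dom : (u : AName A) → u.Idx → AName A
  | mk _ d _ => d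

/-- The values of `u` on its domain. -/
def val : (u : AName A) → u.Idx → A
  | mk _ _ a => a

/-- The truth value `‖u = v‖`, the implication of the algebra being `imp`:
`⋀_{x ∈ dom u} (u(x) ⇒ ‖x ∈ v‖) ⊓ ⋀_{y ∈ dom v} (v(y) ⇒ ‖y ∈ u‖)`, where
`‖x ∈ v‖ = ⋁_{y ∈ dom v} v(y) ⊓ ‖x = y‖`. -/
def eqVal [CompleteLattice A] (imp : A → A → A) : AName A → AName A → A
  | mk ι x a, mk κ y b =>
    (⨅ i : ι, imp (a i) (⨆ j : κ, b j ⊓ eqVal imp (x i) (y j))) ⊓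
      (⨅ j : κ, imp (b j) (⨆ i : ι, a i ⊓ eqVal imp (x i) (y j)))

/-- The truth value `‖x ∈ v‖ = ⋁_{y ∈ dom v} v(y) ⊓ ‖x = y‖`. -/
def memVal [CompleteLattice A] (imp : A → A → A) (x v : AName A) : A :=
  ⨆ j : v.Idx, v.val j ⊓ eqVal imp x (v.dom j)

/-- The standard name of a set of the ground universe. -/
def check [CompleteLattice A] : PSet.{u} → AName A
  | PSet.mk ι x => mk ι (fun i => check (x i)) (fun _ => ⊤)

end AName

/-- The Kuratowski pair of two sets. -/
def setPair (x y : PSet.{u}) : PSet.{u} := {{x}, {x, y}}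

/-- A rational number as a hereditarily finite set: the fraction `n / d` in lowest terms is the pair
of the integer `n`, itself the pair of its positive and negative parts, and the von Neumann
natural number `d`. -/
def ratSet (q : ℚ) : PSet.{u} :=
  setPair (setPair (PSet.ofNat q.num.toNat) (PSet.ofNat (-q.num).toNat)) (PSet.ofNat q.den)

/-- The set of all rational numbers. -/
def ratsSet : PSet.{u} := ⟨ULift.{u} ℚ, fun q => ratSet q.down⟩

namespace AName

variable {A : Type u} [Order.Frame A]

/-- `‖q̂ ∈ u‖`, in the Heyting valued universe. -/
def ratMem (u : AName A) (q : ℚ) : A := memVal (· ⇨ ·) (check (ratSet q)) u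

/-- The truth value, in the Heyting valued universe, of "`u` is a Dedekind real", where a real is the
upper part of a Dedekind cut of the rationals, containing its infimum if that is rational:
`u ⊆ ℚ`, some rational is in `u`, some rational is not in `u`, and
`q ∈ u ↔ ∀ r > q, r ∈ u` for every rational `q`.
(Bounded quantifiers over the standard name of `ℚ` are infima and suprema over `ℚ`.) -/
def dedekindVal (u : AName A) : A :=
  (⨅ i : u.Idx, u.val i ⇨ memVal (· ⇨ ·) (u.dom i) (check ratsSet)) ⊓
  (⨆ q : ℚ, ratMem u q) ⊓
  (⨆ q : ℚ, (ratMem u q)ᶜ) ⊓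
  (⨅ q : ℚ, (ratMem u q ⇨ ⨅ (r : ℚ) (_ : q < r), ratMem u r) ⊓
    ((⨅ (r : ℚ) (_ : q < r), ratMem u r) ⇨ ratMem u q))

/-- The set `ℝ^(A)` of the `u` in `V^(A)` that are Dedekind reals with truth value `⊤`. -/
def DedekindReal (A : Type u) [Order.Frame A] : Type (u + 1) := {u : AName A // dedekindVal u = ⊤}

/-- The family `E_t = ⋀ {‖q̂ ∈ u‖ : q rational, q > t}`, `t` real. -/
def family (u : AName A) (t : ℝ) : A := ⨅ (q : ℚ) (_ : t < (q : ℝ)), ratMem u q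

end AName

/-! ## Weakly self-adjoint operators -/

/-- `WSA(H)`: the weakly self-adjoint operators on `H`, that is, the weakly right-continuous spectral
families of projections on `H`. Compared with a right-continuous spectral family, the
condition `⋁_t F_t = 1` is dropped. -/
@[ext] structure WSA (H : Type u) [NormedAddCommGroup H] [InnerProductSpace ℂ H] where
  proj : ℝ → ProjLattice H
  iInf_eq : ⨅ t, proj t = ⊥
  right_cont : ∀ t, ⨅ (s : ℝ) (_ : t < s), proj s = proj t

/-!
Since `eps` is the upper adjoint of `das`, it preserves infima, and it sends `⊥` to `⊥`; this makes
`t ↦ eps (family u t)` a weakly right-continuous spectral family.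

Being a lower adjoint, `das` preserves joins, so `das (eps S)ᶜ ⊔ das (eps S) = das ⊤ = ⊤`. Hence
`starImp S T = ⊤` as soon as `das (eps S) ≤ T`, and `S ⇨ T ≤ starImp S T`, so the truth values of
Heyting valued equality and membership are bounded by those computed with `starImp`.

If `G u = G v`, then `‖q̂ ∈ u‖` and `‖q̂ ∈ v‖` have the same `eps` for every rational `q`. To pass
to equality of names one uses the context `{⊥, ⊤}`: its Stone space has at most one point, so two
disjoint clopen subobjects cannot both be nonzero. A member `x` of `dom u` with `u(x) ≠ ⊥` therefore equals
one and the same rational `q` to the extent `u(x)`, and `das (eps u(x))` lies below `‖x = q̂‖` and,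
through `eps ‖q̂ ∈ u‖ = eps ‖q̂ ∈ v‖`, below `‖q̂ ∈ v‖`; hence it lies below `‖x ∈ v‖`.
-/

namespace CompleteOrthomodularLattice

variable {L : Type u} [CompleteOrthomodularLattice L]

theorem ocompl_bot : (⊥ : L)ᶜ = ⊤ := by
  simpa only [bot_sup_eq] using sup_ocompl_self (⊥ : L)

theorem ocompl_top : (⊤ : L)ᶜ = ⊥ := by
  simpa only [top_inf_eq] using inf_ocompl_self (⊤ : L)

end CompleteOrthomodularLattice

namespace BoolContext

variable {L : Type u} [CompleteOrthomodularLattice L]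

/-- The smallest context `{⊥, ⊤}`, into which every clopen subobject restricts. -/
def trivial (L : Type u) [CompleteOrthomodularLattice L] : BoolContext L where
  alg := CompleteSublattice.mk' {⊥, ⊤}
    (fun s hs => by
      by_cases h : ⊤ ∈ s
      · exact Or.inr (top_le_iff.1 (le_sSup h))
      · exact Or.inl (sSup_eq_bot.2 fun a ha => (hs ha).resolve_right (ne_of_mem_of_not_mem ha h)))
    (fun s hs => by
      by_cases h : ⊥ ∈ s
      · exact Or.inl (le_bot_iff.1 (sInf_le h))
      · exact Or.inr (sInf_eq_top.2 fun a ha => (hs ha).resolve_left (ne_of_mem_of_not_mem ha h)))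
  compl_mem := by
    rintro a (rfl | rfl)
    · exact Or.inr CompleteOrthomodularLattice.ocompl_bot
    · exact Or.inl CompleteOrthomodularLattice.ocompl_top
  distrib := by
    rintro a (rfl | rfl) b - c - <;> simp

theorem trivial_le (B : BoolContext L) : (trivial L).alg ≤ B.alg := by
  rintro a (rfl | rfl)
  · exact B.alg.bot_mem
  · exact B.alg.top_mem

instance : Subsingleton (StoneSpace (trivial L)) where
  allEq x y := by
    refine DFunLike.ext (F := BoundedLatticeHom (trivial L).alg Bool) x y ?_
    rintro ⟨a, rfl | rfl⟩
    · exact x.eval_bot.trans y.eval_bot.symm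
    · exact x.eval_top.trans y.eval_top.symm

/-- The approximation of `a` from above in the context `B`, that is, the least element of `B` above
`a`; it is the element whose basic set is the component of `SubCl.das a` at `B`. -/
def upper (B : BoolContext L) (a : L) : B.alg := sInf {b : B.alg | a ≤ b.1}

theorem le_upper (B : BoolContext L) (a : L) : a ≤ (B.upper a).1 := by
  rw [upper, CompleteSublattice.coe_sInf']
  exact le_iInf₂ fun _ hb => hb

theorem upper_le_iff {B : BoolContext L} {a : L} {b : B.alg} : B.upper a ≤ b ↔ a ≤ b.1 :=
  ⟨(B.le_upper a).trans, fun h => sInf_le h⟩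

end BoolContext

namespace StoneSpace

variable {L : Type u} [CompleteOrthomodularLattice L] {B : BoolContext L}

theorem basic_ctxCompl (b : B.alg) : basic (ctxCompl b) = (basic b)ᶜ := by
  ext x
  simp [basic, eval_ctxCompl]

theorem le_of_basic_subset_basic {b c : B.alg} (h : basic b ⊆ basic c) : b ≤ c := by
  let _ : DistribLattice B.alg := distribLattice B
  have hdisj : Disjoint b (ctxCompl c) := by
    rw [disjoint_iff]
    by_contra hne
    obtain ⟨x, hx⟩ := basic_nonempty hne
    have hxc : x ∈ basic (ctxCompl c) := eval_mono x inf_le_right hx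
    rw [basic_ctxCompl] at hxc
    exact hxc (h (eval_mono x inf_le_left hx))
  exact hdisj.le_of_codisjoint (codisjoint_iff.2 (sup_ctxCompl c)).symm

end StoneSpace

namespace SubCl

variable {L : Type u} [CompleteOrthomodularLattice L]

theorem obj_bot (B : BoolContext L) : (⊥ : SubCl L).obj B = ∅ := by
  let S : SubCl L := ⟨fun _ => ∅, fun _ => isClopen_empty, fun _ _ _ _ hx => hx⟩
  exact Set.subset_empty_iff.1 ((bot_le : ⊥ ≤ S) B)

theorem obj_trivial_nonempty {S : SubCl L} (hS : S ≠ ⊥) :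
    (S.obj (BoolContext.trivial L)).Nonempty := by
  contrapose! hS
  refine le_bot_iff.1 fun B x hx => ?_
  have hmem := S.restrict_mem B _ B.trivial_le x hx
  rw [hS] at hmem
  exact hmem.elim

theorem eq_bot_or_eq_bot_of_disjoint {S T : SubCl L} (h : Disjoint S T) : S = ⊥ ∨ T = ⊥ := by
  by_contra! hne
  obtain ⟨x, hx⟩ := obj_trivial_nonempty hne.1
  obtain ⟨y, hy⟩ := obj_trivial_nonempty hne.2
  have hxST : x ∈ (S ⊓ T).obj (BoolContext.trivial L) := ⟨hx, Subsingleton.elim y x ▸ hy⟩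
  rw [h.eq_bot, obj_bot] at hxST
  exact hxST

theorem das_mono : Monotone (das : L → SubCl L) := fun _ b h B x hx =>
  x.eval_mono (BoolContext.upper_le_iff.2 (h.trans (B.le_upper b))) hx

theorem das_eps_le (S : SubCl L) : das (eps S) ≤ S := by
  intro B x hx
  by_contra hxS
  obtain ⟨d, hxd, hd⟩ := StoneSpace.exists_basic (S.isClopen B).1.isOpen_compl hxS
  have heps : eps S ≤ (StoneSpace.ctxCompl d).1 := sSup_le fun a ha => by
    refine BoolContext.upper_le_iff.1 (StoneSpace.le_of_basic_subset_basic ?_)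
    rw [StoneSpace.basic_ctxCompl]
    exact (ha B).trans (Set.subset_compl_comm.1 hd)
  have hxd' : x ∈ StoneSpace.basic (StoneSpace.ctxCompl d) :=
    x.eval_mono (BoolContext.upper_le_iff.2 heps) hx
  rw [StoneSpace.basic_ctxCompl] at hxd'
  exact hxd' hxd

theorem gc_das_eps : GaloisConnection (das : L → SubCl L) eps := fun _ S =>
  ⟨fun h => le_sSup h, fun h => (das_mono h).trans (das_eps_le S)⟩

theorem das_top : das (⊤ : L) = ⊤ := by
  refine top_le_iff.1 fun B x _ => ?_
  have htop : B.upper ⊤ = ⊤ := top_le_iff.1 (B.le_upper ⊤)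
  exact (congrArg x.eval htop).trans x.eval_top

theorem eq_bot_of_das_eq_bot {a : L} (h : das a = ⊥) : a = ⊥ := by
  have hupper : (BoolContext.trivial L).upper a = ⊥ := by
    by_contra hne
    have hbasic : StoneSpace.basic ((BoolContext.trivial L).upper a) = ∅ :=
      (congrArg (fun S : SubCl L => S.obj (BoolContext.trivial L)) h).trans (obj_bot _)
    exact (StoneSpace.basic_nonempty hne).ne_empty hbasic
  exact le_bot_iff.1 (BoolContext.upper_le_iff.1 hupper.le)

theorem eps_bot : eps (⊥ : SubCl L) = ⊥ :=
  eq_bot_of_das_eq_bot (le_bot_iff.1 (das_eps_le ⊥))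

theorem starImp_eq_top {S T : SubCl L} (h : das (eps S) ≤ T) : starImp S T = ⊤ :=
  top_le_iff.1 <| calc
    ⊤ = das ((eps S)ᶜ ⊔ eps S) := by
      rw [sup_comm, CompleteOrthomodularLattice.sup_ocompl_self, das_top]
    _ = star S ⊔ das (eps S) := gc_das_eps.l_sup
    _ ≤ starImp S T := sup_le_sup_left h _

theorem starImp_eq_top_of_eps_eq {S T : SubCl L} (h : eps S = eps T) : starImp S T = ⊤ :=
  starImp_eq_top (h ▸ das_eps_le T)

theorem starImp_mono_right (S : SubCl L) : Monotone (starImp S) := fun _ _ h =>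
  sup_le_sup_left h _

theorem himp_le_starImp (S T : SubCl L) : S ⇨ T ≤ starImp S T := by
  have hcodisj : Codisjoint (star S) S := codisjoint_iff.2 (starImp_eq_top (das_eps_le S))
  exact (hcodisj.mono_left le_sup_left).himp_le_of_right_le le_sup_right

end SubCl

namespace AName

variable {A : Type u}

section CompleteLattice

variable [CompleteLattice A]

theorem eqVal_comm (imp : A → A → A) (u v : AName A) : eqVal imp u v = eqVal imp v u := by
  induction u generalizing v with
  | mk ι x a ih =>
    cases v with
    | mk κ y b =>
      rw [eqVal, eqVal, inf_comm]
      simp only [ih]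

theorem eqVal_eq (imp : A → A → A) (u v : AName A) :
    eqVal imp u v = (⨅ i, imp (u.val i) (memVal imp (u.dom i) v)) ⊓
      (⨅ j, imp (v.val j) (memVal imp (v.dom j) u)) := by
  simp only [memVal, fun i j => eqVal_comm imp (v.dom j) (u.dom i)]
  cases u
  cases v
  rw [eqVal]
  rfl

theorem eqVal_mono_imp {imp imp' : A → A → A} (hle : ∀ a b, imp a b ≤ imp' a b)
    (hmono : ∀ a, Monotone (imp' a)) (u v : AName A) : eqVal imp u v ≤ eqVal imp' u v := by
  induction u generalizing v with
  | mk ι x a ih =>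
    cases v with
    | mk κ y b =>
      rw [eqVal, eqVal]
      refine inf_le_inf (iInf_mono fun i => (hle _ _).trans (hmono _ ?_))
        (iInf_mono fun j => (hle _ _).trans (hmono _ ?_))
      · exact iSup_mono fun j => inf_le_inf_left _ (ih i _)
      · exact iSup_mono fun i => inf_le_inf_left _ (ih i _)

theorem memVal_mono_imp {imp imp' : A → A → A} (hle : ∀ a b, imp a b ≤ imp' a b)
    (hmono : ∀ a, Monotone (imp' a)) (x v : AName A) : memVal imp x v ≤ memVal imp' x v :=
  iSup_mono fun _ => inf_le_inf_left _ (eqVal_mono_imp hle hmono _ _)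

theorem memVal_check (imp : A → A → A) (x : AName A) (s : PSet.{u}) :
    memVal imp x (check s) = ⨆ i : s.Type, eqVal imp x (check (s.Func i)) := by
  cases s
  exact iSup_congr fun i => top_inf_eq _

end CompleteLattice

variable [Order.Frame A]

local infix:75 " ≈ₕ " => eqVal (· ⇨ ·)
local infix:75 " ∈ₕ " => memVal (· ⇨ ·)

theorem le_eqVal_iff {c : A} {u v : AName A} :
    c ≤ u ≈ₕ v ↔ (∀ i, u.val i ⊓ c ≤ u.dom i ∈ₕ v) ∧ ∀ j, v.val j ⊓ c ≤ v.dom j ∈ₕ u := by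
  simp only [eqVal_eq, le_inf_iff, le_iInf_iff, le_himp_iff']

theorem val_inf_eqVal_le (u v : AName A) (i : u.Idx) :
    u.val i ⊓ u ≈ₕ v ≤ u.dom i ∈ₕ v :=
  (le_eqVal_iff.1 le_rfl).1 i

theorem eqVal_inf_memVal_le_of_trans {x y : AName A}
    (htrans : ∀ z, x ≈ₕ y ⊓ y ≈ₕ z ≤ x ≈ₕ z) (v : AName A) :
    x ≈ₕ y ⊓ y ∈ₕ v ≤ x ∈ₕ v := by
  rw [memVal, memVal, inf_iSup_eq]
  refine iSup_mono fun j => ?_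
  rw [inf_left_comm]
  exact inf_le_inf_left _ (htrans _)

theorem memVal_inf_eqVal_le_of_trans {v : AName A}
    (htrans : ∀ j x z, x ≈ₕ v.dom j ⊓ v.dom j ≈ₕ z ≤ x ≈ₕ z) (x w : AName A) :
    x ∈ₕ v ⊓ v ≈ₕ w ≤ x ∈ₕ w := by
  rw [memVal, iSup_inf_eq]
  refine iSup_le fun j => ?_
  calc v.val j ⊓ x ≈ₕ v.dom j ⊓ v ≈ₕ w
      = x ≈ₕ v.dom j ⊓ (v.val j ⊓ v ≈ₕ w) := by rw [inf_comm (v.val j), inf_assoc]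
    _ ≤ x ≈ₕ v.dom j ⊓ v.dom j ∈ₕ w := inf_le_inf_left _ (val_inf_eqVal_le v w j)
    _ ≤ x ∈ₕ w := eqVal_inf_memVal_le_of_trans (htrans j x) w

-- Induction on the middle name makes both halves of the equality instances of one substitution law.
theorem eqVal_trans (u v w : AName A) : u ≈ₕ v ⊓ v ≈ₕ w ≤ u ≈ₕ w := by
  induction v generalizing u w with
  | mk κ y b ih =>
    have hsubst : ∀ x w : AName A, x ∈ₕ mk κ y b ⊓ mk κ y b ≈ₕ w ≤ x ∈ₕ w :=
      memVal_inf_eqVal_le_of_trans fun j x z => ih j x z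
    have hval : ∀ (u w : AName A) (i : u.Idx),
        u.val i ⊓ (u ≈ₕ mk κ y b ⊓ mk κ y b ≈ₕ w) ≤ u.dom i ∈ₕ w := fun u w i => by
      rw [← inf_assoc]
      exact (inf_le_inf_right _ (val_inf_eqVal_le u _ i)).trans (hsubst _ w)
    refine le_eqVal_iff.2 ⟨hval u w, fun k => ?_⟩
    rw [inf_comm (u ≈ₕ _), eqVal_comm _ u, eqVal_comm _ _ w]
    exact hval w u k

theorem eqVal_inf_memVal_le (x y v : AName A) : x ≈ₕ y ⊓ y ∈ₕ v ≤ x ∈ₕ v :=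
  eqVal_inf_memVal_le_of_trans (eqVal_trans x y) v

theorem eqVal_self (u : AName A) : u ≈ₕ u = ⊤ := by
  induction u with
  | mk ι x a ih =>
    have hmem : ∀ i : ι, a i ⊓ ⊤ ≤ x i ∈ₕ mk ι x a := fun i =>
      le_iSup_of_le (f := fun j : ι => a j ⊓ x i ≈ₕ x j) i (by rw [ih])
    exact top_le_iff.1 (le_eqVal_iff.2 ⟨hmem, hmem⟩)

theorem val_le_memVal (u : AName A) (i : u.Idx) : u.val i ≤ u.dom i ∈ₕ u := by
  simpa only [eqVal_self, inf_top_eq] using val_inf_eqVal_le u u i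

theorem eqVal_check_eq_top {x y : PSet.{u}} (h : x.Equiv y) :
    (check x : AName A) ≈ₕ check y = ⊤ := by
  induction x generalizing y with
  | mk ι x ih =>
    cases y with
    | mk κ y =>
      refine top_le_iff.1 (le_eqVal_iff.2 ⟨fun i => ?_, fun j => ?_⟩)
      · obtain ⟨j, hj⟩ := h.1 i
        exact le_top.trans ((ih i hj).ge.trans
          ((le_iSup _ j).trans_eq (memVal_check _ _ (PSet.mk κ y)).symm))
      · obtain ⟨i, hi⟩ := h.2 j
        rw [memVal_check]
        refine le_top.trans ((ih i hi).ge.trans ?_)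
        rw [eqVal_comm]
        exact le_iSup (fun i : ι => check (y j) ≈ₕ check (x i)) i

theorem eqVal_check_eq_bot {x y : PSet.{u}} (h : ¬ x.Equiv y) :
    (check x : AName A) ≈ₕ check y = ⊥ := by
  induction x generalizing y with
  | mk ι x ih =>
    cases y with
    | mk κ y =>
      rw [PSet.Equiv.eq_def] at h
      simp only [not_and_or, not_forall, not_exists] at h
      rw [check, check, eqVal, ← le_bot_iff]
      rcases h with ⟨i, hi⟩ | ⟨j, hj⟩
      · refine inf_le_left.trans ((iInf_le _ i).trans ?_)
        simp [ih i (hi _)]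
      · refine inf_le_right.trans ((iInf_le _ j).trans ?_)
        simp [ih _ (hj _)]

theorem eqVal_check_le_of_equiv (x : AName A) {s t : PSet.{u}} (h : s.Equiv t) :
    x ≈ₕ check s ≤ x ≈ₕ check t := by
  simpa only [eqVal_check_eq_top h, inf_top_eq] using eqVal_trans x (check s) (check t)

theorem disjoint_eqVal_check (x : AName A) {s t : PSet.{u}} (h : ¬ s.Equiv t) :
    Disjoint (x ≈ₕ check s) (x ≈ₕ check t) := by
  rw [disjoint_iff_inf_le, eqVal_comm _ x (check s), ← eqVal_check_eq_bot (A := A) h]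
  exact eqVal_trans _ _ _

theorem exists_memVal_check_le_eqVal (hA : ∀ ⦃a b : A⦄, Disjoint a b → a = ⊥ ∨ b = ⊥)
    {x : AName A} {s : PSet.{u}} (hx : x ∈ₕ check s ≠ ⊥) :
    ∃ i : s.Type, x ∈ₕ check s ≤ x ≈ₕ check (s.Func i) := by
  rw [memVal_check] at hx ⊢
  obtain ⟨i, hi⟩ : ∃ i, x ≈ₕ check (s.Func i) ≠ ⊥ := by
    simpa only [ne_eq, iSup_eq_bot, not_forall] using hx
  refine ⟨i, iSup_le fun j => ?_⟩
  by_cases hij : (s.Func j).Equiv (s.Func i)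
  · exact eqVal_check_le_of_equiv x hij
  · exact ((hA (disjoint_eqVal_check x hij)).resolve_right hi).le.trans bot_le

theorem dedekindVal_eq_top_iff {u : AName A} :
    dedekindVal u = ⊤ ↔ (∀ i, u.val i ≤ u.dom i ∈ₕ check ratsSet) ∧ (⨆ q, ratMem u q = ⊤) ∧
      (⨆ q, (ratMem u q)ᶜ = ⊤) ∧ ∀ q, ratMem u q = ⨅ (r : ℚ) (_ : q < r), ratMem u r := by
  simp only [dedekindVal, inf_eq_top_iff, iInf_eq_top, himp_eq_top_iff, and_assoc,
    le_antisymm_iff (a := ratMem u _)]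

theorem family_ratCast {u : AName A} (hu : dedekindVal u = ⊤) (q : ℚ) :
    family u q = ratMem u q := by
  simpa only [family, Rat.cast_lt] using ((dedekindVal_eq_top_iff.1 hu).2.2.2 q).symm

theorem iInf_ratMem_eq_bot {u : AName A} (hu : dedekindVal u = ⊤) : ⨅ q, ratMem u q = ⊥ :=
  le_compl_self.1 <| calc
    ⨅ q, ratMem u q ≤ ⊤ := le_top
    _ = ⨆ q, (ratMem u q)ᶜ := (dedekindVal_eq_top_iff.1 hu).2.2.1.symm
    _ ≤ (⨅ q, ratMem u q)ᶜ := iSup_le fun q => compl_anti (iInf_le _ q)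

theorem iInf_family_eq_bot {u : AName A} (hu : dedekindVal u = ⊤) : ⨅ t, family u t = ⊥ := by
  rw [← le_bot_iff, ← iInf_ratMem_eq_bot hu]
  exact le_iInf fun q => (iInf_le _ (q : ℝ)).trans (family_ratCast hu q).le

theorem iInf_family_gt (u : AName A) (t : ℝ) :
    ⨅ (s : ℝ) (_ : t < s), family u s = family u t := by
  refine le_antisymm (le_iInf₂ fun q hq => ?_) (le_iInf₂ fun s hs => le_iInf₂ fun q hq => ?_)
  · obtain ⟨s, hts, hsq⟩ := exists_between hq
    exact (iInf₂_le s hts).trans (iInf₂_le q hsq)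
  · exact iInf₂_le q (hs.trans hq)

theorem exists_val_le_eqVal_ratSet (hA : ∀ ⦃a b : A⦄, Disjoint a b → a = ⊥ ∨ b = ⊥)
    {u : AName A} (hu : dedekindVal u = ⊤) {i : u.Idx} (hi : u.val i ≠ ⊥) :
    ∃ q, u.val i ≤ u.dom i ≈ₕ check (ratSet q) := by
  have hle : u.val i ≤ u.dom i ∈ₕ check ratsSet := (dedekindVal_eq_top_iff.1 hu).1 i
  obtain ⟨q, hq⟩ := exists_memVal_check_le_eqVal hA (ne_bot_of_le_ne_bot hi hle)
  exact ⟨q.down, hle.trans hq⟩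

end AName

namespace SubCl

variable {L : Type u} [CompleteOrthomodularLattice L]

open AName

theorem starImp_val_memVal_eq_top {u v : AName (SubCl L)} (hu : dedekindVal u = ⊤)
    (h : ∀ q, eps (ratMem u q) = eps (ratMem v q)) (i : u.Idx) :
    starImp (u.val i) (memVal starImp (u.dom i) v) = ⊤ := by
  apply starImp_eq_top
  by_cases hi : u.val i = ⊥
  · exact (das_eps_le _).trans (hi.le.trans bot_le)
  obtain ⟨q, hq⟩ := exists_val_le_eqVal_ratSet (fun _ _ => eq_bot_or_eq_bot_of_disjoint) hu hi
  have hratMem_u : u.val i ≤ ratMem u q :=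
    (le_inf (hq.trans (eqVal_comm _ _ _).le) (val_le_memVal u i)).trans (eqVal_inf_memVal_le _ _ _)
  have hratMem_v : das (eps (u.val i)) ≤ ratMem v q := calc
    das (eps (u.val i)) ≤ das (eps (ratMem u q)) := das_mono (gc_das_eps.monotone_u hratMem_u)
    _ = das (eps (ratMem v q)) := by rw [h q]
    _ ≤ ratMem v q := das_eps_le _
  calc das (eps (u.val i))
      ≤ eqVal (· ⇨ ·) (u.dom i) (check (ratSet q)) ⊓ ratMem v q :=
        le_inf ((das_eps_le _).trans hq) hratMem_v
    _ ≤ memVal (· ⇨ ·) (u.dom i) v := eqVal_inf_memVal_le _ _ _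
    _ ≤ memVal starImp (u.dom i) v := memVal_mono_imp himp_le_starImp starImp_mono_right _ _

theorem eqVal_starImp_eq_top {u v : AName (SubCl L)} (hu : dedekindVal u = ⊤)
    (hv : dedekindVal v = ⊤) (h : ∀ q, eps (ratMem u q) = eps (ratMem v q)) :
    eqVal starImp u v = ⊤ := by
  rw [eqVal_eq, inf_eq_top_iff, iInf_eq_top, iInf_eq_top]
  exact ⟨starImp_val_memVal_eq_top hu h, starImp_val_memVal_eq_top hv fun q => (h q).symm⟩

end SubCl

/-- The weakly right-continuous spectral families in a complete lattice; those in `P(H)` are the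
members of `WSA H`. -/
@[ext] structure WeakSpectralFamily (L : Type u) [CompleteLattice L] where
  proj : ℝ → L
  iInf_eq : ⨅ t, proj t = ⊥
  right_cont : ∀ t, ⨅ (s : ℝ) (_ : t < s), proj s = proj t

namespace WeakSpectralFamily

/-- The spectral family `t ↦ ε(E_t)` of a Dedekind real over the clopen subobjects. -/
def ofReal {L : Type u} [CompleteOrthomodularLattice L]
    (u : AName.DedekindReal (SubCl L)) : WeakSpectralFamily L where
  proj t := SubCl.eps (AName.family u.1 t)
  iInf_eq := by
    rw [← SubCl.gc_das_eps.u_iInf, AName.iInf_family_eq_bot u.2, SubCl.eps_bot]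
  right_cont t := by
    simp only [← SubCl.gc_das_eps.u_iInf, AName.iInf_family_gt]

theorem eps_ratMem_eq_of_ofReal_eq {L : Type u} [CompleteOrthomodularLattice L]
    {u v : AName.DedekindReal (SubCl L)} (h : ofReal u = ofReal v) (q : ℚ) :
    SubCl.eps (AName.ratMem u.1 q) = SubCl.eps (AName.ratMem v.1 q) := by
  rw [← AName.family_ratCast u.2, ← AName.family_ratCast v.2]
  exact congrFun (congrArg proj h) q

/-- A weakly right-continuous spectral family in `P(H)`, as a weakly self-adjoint operator. -/
def toWSA {H : Type u} [NormedAddCommGroup H] [InnerProductSpace ℂ H]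
    (F : WeakSpectralFamily (ProjLattice H)) : WSA H :=
  ⟨F.proj, F.iInf_eq, F.right_cont⟩

theorem toWSA_injective {H : Type u} [NormedAddCommGroup H] [InnerProductSpace ℂ H] :
    Function.Injective (toWSA (H := H)) := fun _ _ h =>
  WeakSpectralFamily.ext (congrArg WSA.proj h)

end WeakSpectralFamily

theorem mainTheorem4_general {L : Type u} [CompleteOrthomodularLattice L] :
    ∃ G : AName.DedekindReal (SubCl L) → WeakSpectralFamily L,
      (∀ (u : AName.DedekindReal (SubCl L)) (t : ℝ),
        (G u).proj t = (SubCl.toClass (AName.family u.1 t)).g) ∧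
      (∀ u v : AName.DedekindReal (SubCl L),
        AName.eqVal SubCl.starImp u.1 v.1 ≠ ⊤ → G u ≠ G v) ∧
      (∀ u v : AName.DedekindReal (SubCl L),
        (⨅ q : ℚ, SubCl.starImp (AName.ratMem u.1 q) (AName.ratMem v.1 q) ⊓
          SubCl.starImp (AName.ratMem v.1 q) (AName.ratMem u.1 q)) ≠ ⊤ → G u ≠ G v) := by
  refine ⟨WeakSpectralFamily.ofReal, fun _ _ => rfl, fun u v hne hG => hne ?_,
    fun u v hne hG => hne (iInf_eq_top.2 fun q => ?_)⟩
  · exact SubCl.eqVal_starImp_eq_top u.2 v.2 (WeakSpectralFamily.eps_ratMem_eq_of_ofReal_eq hG)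
  · have heps := WeakSpectralFamily.eps_ratMem_eq_of_ofReal_eq hG q
    exact inf_eq_top_iff.2
      ⟨SubCl.starImp_eq_top_of_eps_eq heps, SubCl.starImp_eq_top_of_eps_eq heps.symm⟩

theorem mainTheorem4 {H : Type u} [NormedAddCommGroup H] [InnerProductSpace ℂ H]
    [CompleteSpace H] :
    ∃ G : AName.DedekindReal (SubCl (ProjLattice H)) → WSA H,
      (∀ (u : AName.DedekindReal (SubCl (ProjLattice H))) (t : ℝ),
        (G u).proj t = (SubCl.toClass (AName.family u.1 t)).g) ∧
      (∀ u v : AName.DedekindReal (SubCl (ProjLattice H)),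
        AName.eqVal SubCl.starImp u.1 v.1 ≠ ⊤ → G u ≠ G v) ∧
      (∀ u v : AName.DedekindReal (SubCl (ProjLattice H)),
        (⨅ q : ℚ, SubCl.starImp (AName.ratMem u.1 q) (AName.ratMem v.1 q) ⊓
          SubCl.starImp (AName.ratMem v.1 q) (AName.ratMem u.1 q)) ≠ ⊤ → G u ≠ G v) := by
  obtain ⟨G, hproj, heqVal, hratMem⟩ := mainTheorem4_general (L := ProjLattice H)
  exact ⟨fun u => (G u).toWSA, hproj,
    fun u v h => WeakSpectralFamily.toWSA_injective.ne (heqVal u v h),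
    fun u v h => WeakSpectralFamily.toWSA_injective.ne (hratMem u v h)⟩
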